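/- Let $n\ge 1$ be an integer, $s\in(0,1)$, $p>1$ with $n>sp$, and let $\Omega\subset\mathbb R^n$ be bounded and open. Write $v_+=\max\{v,0\}$, $v_-=\max\{-v,0\}$, let $B_R(x_0)$ be the open ball, and put $$[v]_{W^{s,p}(U)}=\Big(\int_U\int_U\frac{|v(x)-v(y)|^p}{|x-y|^{n+sp}}\,dx\,dy\Big)^{1/p},\qquad \mathrm{Tail}_{s,p}(v;x_0,R)=\Big(R^{sp}\int_{\mathbb R^n\setminus B_R(x_0)}\frac{|v(x)|^{p-1}}{|x-x_0|^{n+sp}}\,dx\Big)^{\frac1{p-1}},$$ $\overline{\mathrm{Tail}}_{s,p}(v;x_0,R)=R^{-\frac{sp}{p-1}}\,\mathrm{Tail}_{s,p}(v;x_0,R)$. Let $d,\lambda\ge0$ and $H\ge1$. The class $\mathrm{wDG}^{\pm}(\Omega;d,H,\lambda)$ consists of the measurable functions $u:\mathbb R^n\to\mathbb R$ with $\int_{\mathbb R^n}\frac{|u(x)|^{p-1}}{(1+|x|)^{n+sp}}\,dx<\infty$, $u\in L^p(\Omega)$ and $[u]_{W^{s,p}(\Omega)}<\infty$, such that $$[(u-k)_\pm]_{W^{s,p}(B_r(x_0))}^p\le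 H\Big\{R^\lambda d^p\,|A^\pm_k\cap B_R(x_0)|+\frac{R^{(1-s)p}}{(R-r)^p}\|(u-k)_\pm\|^p_{L^p(B_R(x_0))}+\frac{R^{n+sp}}{(R-r)^{n+sp}}\|(u-k)_\pm\|_{L^1(B_R(x_0))}\,\overline{\mathrm{Tail}}_{s,p}((u-k)_\pm;x_0,r)^{p-1}\Big\}$$ for all $x_0\in\Omega$, $0<r<R<\mathrm{dist}(x_0,\partial\Omega)$ and $k\in\mathbb R$, where $A^+_k=\{u>k\}$ and $A^-_k=\{u<k\}$. Set $\mathrm{wDG}(\Omega;d,H,\lambda)=\mathrm{wDG}^+(\Omega;d,H,\lambda)\cap\mathrm{wDG}^-(\Omega;d,H,\lambda)$. **Theorem.** (i) There is a constant $C\ge1$ depending only on $n,s,p,H$ such that every $u\in\mathrm{wDG}(\Omega;d,H,\lambda)$ belongs to $L^\infty_{\mathrm{loc}}(\Omega)$ and satisfies $$\|u\|_{L^\infty(B_R(x_0))}\le C\Big\{\Big(\frac1{|B_{2R}(x_0)|}\int_{B_{2R}(x_0)}|u|^p\,dx\Big)^{1/p}+\mathrm{Tail}_{s,p}(u;x_0,R)+R^{\frac{\lambda+sp}{p}}d\Big\}$$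 for every $x_0\in\Omega$ and $0<R<\mathrm{dist}(x_0,\partial\Omega)/2$. (ii) There is a constant $C\ge1$ depending only on $n,s,p,H$ such that every $u\in\mathrm{wDG}^+(\Omega;d,H,\lambda)$ satisfies $$\operatorname*{ess\,sup}_{B_R(x_0)}u\le C\Big\{\Big(\frac1{|B_{2R}(x_0)|}\int_{B_{2R}(x_0)}u_+^p\,dx\Big)^{1/p}+\mathrm{Tail}_{s,p}(u_+;x_0,R)+R^{\frac{\lambda+sp}{p}}d\Big\}$$ for every $x_0\in\Omega$ and $0<R<\mathrm{dist}(x_0,\partial\Omega)/2$. -/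

import Mathlib

open MeasureTheory
open scoped ENNReal NNReal

noncomputable section

namespace FracDeGiorgi

/-- The Gagliardo seminorm
`[u]_{W^{s,p}(U)} = (∫_U ∫_U |u x - u y|^p / |x - y|^(n + s p) dx dy)^(1/p)`, with values in `[0, ∞]`. -/
def gagliardoSeminorm {n : ℕ} (s p : ℝ) (u : EuclideanSpace ℝ (Fin n) → ℝ)
    (U : Set (EuclideanSpace ℝ (Fin n))) : ℝ≥0∞ :=
  (∫⁻ x in U, ∫⁻ y in U, ‖u x - u y‖ₑ ^ p / ‖x - y‖ₑ ^ ((n : ℝ) + s * p)) ^ (1 / p)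

/-- Membership of `u|_U` in the fractional Sobolev space `W^{s,p}(U)`. -/
def MemFracSobolev {n : ℕ} (s p : ℝ) (u : EuclideanSpace ℝ (Fin n) → ℝ)
    (U : Set (EuclideanSpace ℝ (Fin n))) : Prop :=
  MemLp u (ENNReal.ofReal p) (volume.restrict U) ∧ gagliardoSeminorm s p u U < ∞

/-- Membership in the weighted Lebesgue space `L^{p-1}_s(ℝⁿ)`: `u` is (Lebesgue) measurable and
`∫ |u x|^(p-1) / (1 + |x|)^(n + s p) dx < ∞`. -/
def MemTailSpace {n : ℕ} (s p : ℝ) (u : EuclideanSpace ℝ (Fin n) → ℝ) : Prop :=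
  AEMeasurable u volume ∧
    ∫⁻ x, ‖u x‖ₑ ^ (p - 1) / (1 + ‖x‖ₑ) ^ ((n : ℝ) + s * p) < ∞

/-- `Tail_{s,p}(u; x₀, R) = (R^(s p) ∫_{ℝⁿ ∖ B_R(x₀)} |u x|^(p-1) / |x - x₀|^(n + s p) dx)^(1/(p-1))`,
with values in `[0, ∞]`; it is finite for `R > 0` when `u` lies in `L^{p-1}_s(ℝⁿ)`. -/
def tail {n : ℕ} (s p : ℝ) (u : EuclideanSpace ℝ (Fin n) → ℝ)
    (x₀ : EuclideanSpace ℝ (Fin n)) (R : ℝ) : ℝ≥0∞ :=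
  (ENNReal.ofReal (R ^ (s * p)) *
    ∫⁻ x in (Metric.ball x₀ R)ᶜ, ‖u x‖ₑ ^ (p - 1) / ‖x - x₀‖ₑ ^ ((n : ℝ) + s * p)) ^ (1 / (p - 1))

/-- The rescaled tail `R^(- s p / (p - 1)) Tail_{s,p}(u; x₀, R)`. -/
def tailBar {n : ℕ} (s p : ℝ) (u : EuclideanSpace ℝ (Fin n) → ℝ)
    (x₀ : EuclideanSpace ℝ (Fin n)) (R : ℝ) : ℝ≥0∞ :=
  ENNReal.ofReal (R ^ (-(s * p / (p - 1)))) * tail s p u x₀ R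

/-- The nonlocal Caccioppoli inequality on the balls `B_r(x₀) ⊆ B_R(x₀)` for a truncation `v`
with corresponding level set `A`. It is used with `v = (u - k)₊`, `A = {u > k}` and with
`v = (u - k)₋`, `A = {u < k}`. -/
def CaccioppoliIneq {n : ℕ} (s p d H lam : ℝ) (v : EuclideanSpace ℝ (Fin n) → ℝ)
    (A : Set (EuclideanSpace ℝ (Fin n))) (x₀ : EuclideanSpace ℝ (Fin n)) (r R : ℝ) : Prop :=
  gagliardoSeminorm s p v (Metric.ball x₀ r) ^ p ≤
    ENNReal.ofReal H *
      (ENNReal.ofReal (R ^ lam * d ^ p) * volume (A ∩ Metric.ball x₀ R)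
        + ENNReal.ofReal (R ^ ((1 - s) * p) / (R - r) ^ p)
          * eLpNorm v (ENNReal.ofReal p) (volume.restrict (Metric.ball x₀ R)) ^ p
        + ENNReal.ofReal (R ^ ((n : ℝ) + s * p) / (R - r) ^ ((n : ℝ) + s * p))
          * eLpNorm v 1 (volume.restrict (Metric.ball x₀ R))
          * tailBar s p v x₀ r ^ (p - 1))

/-- `wDG⁺(Ω; d, H, λ)`. -/
structure MemWDGPlus {n : ℕ} (s p d H lam : ℝ) (Ω : Set (EuclideanSpace ℝ (Fin n)))
    (u : EuclideanSpace ℝ (Fin n) → ℝ) : Prop where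
  memTailSpace : MemTailSpace s p u
  memFracSobolev : MemFracSobolev s p u Ω
  caccioppoli : ∀ x₀ ∈ Ω, ∀ r R : ℝ, 0 < r → r < R → R < Metric.infDist x₀ (frontier Ω) →
    ∀ k : ℝ, CaccioppoliIneq s p d H lam (fun x => max (u x - k) 0) {x | k < u x} x₀ r R

/-- `wDG⁻(Ω; d, H, λ)`. -/
structure MemWDGMinus {n : ℕ} (s p d H lam : ℝ) (Ω : Set (EuclideanSpace ℝ (Fin n)))
    (u : EuclideanSpace ℝ (Fin n) → ℝ) : Prop where
  memTailSpace : MemTailSpace s p u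
  memFracSobolev : MemFracSobolev s p u Ω
  caccioppoli : ∀ x₀ ∈ Ω, ∀ r R : ℝ, 0 < r → r < R → R < Metric.infDist x₀ (frontier Ω) →
    ∀ k : ℝ, CaccioppoliIneq s p d H lam (fun x => max (-(u x - k)) 0) {x | u x < k} x₀ r R

/-- The weak fractional De Giorgi class `wDG(Ω; d, H, λ) = wDG⁺(Ω; d, H, λ) ∩ wDG⁻(Ω; d, H, λ)`. -/
def MemWDG {n : ℕ} (s p d H lam : ℝ) (Ω : Set (EuclideanSpace ℝ (Fin n)))
    (u : EuclideanSpace ℝ (Fin n) → ℝ) : Prop :=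
  MemWDGPlus s p d H lam Ω u ∧ MemWDGMinus s p d H lam Ω u

/-- `u ∈ L^∞_loc(Ω)`. -/
def MemLinftyLoc {n : ℕ} (Ω : Set (EuclideanSpace ℝ (Fin n)))
    (u : EuclideanSpace ℝ (Fin n) → ℝ) : Prop :=
  ∀ K ⊆ Ω, IsCompact K → MemLp u ∞ (volume.restrict K)

end FracDeGiorgi

end

/-!
The Sobolev inequality enters only through an elementary substitute. If the set where `v ≠ 0` has
small measure in a ball, then around each point of that ball `v` vanishes on at least half of a
small ball of radius `ρ`, where the kernel `|x - y|^(-(n + s p))` is bounded below; integrating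
over these pairs controls `∫ |v|^p` by `[v]^p` with a factor `ρ^(s p)`, that is, with a positive
power of the measure of the set where `v ≠ 0`.

At a level `k` dominating the datum `d` and the tail, the right-hand side of the Caccioppoli
inequality is a multiple of the local energy `∫ (u - κ)₊^p` at a lower level. Combined with the
inequality above, this makes the energies along De Giorgi's radii and levels converge to zero as
soon as the first one is small, so that `u ≤ k` on `B_{R/2}`.

The estimate on `B_R(x₀)` follows by applying this on the balls `B_R(y)`, `y ∈ B_R(x₀)`, with `k` a
multiple of the claimed bound. No radius larger than `R` occurs next to `d`, which is why no factor
`2^λ` appears and the constant does not depend on `λ`. The two-sided bound is the one-sided bound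
for `u` and `-u`.
-/

namespace FracDeGiorgi

open Filter Metric Topology

/-- The ball is centred on the segment from `x` to `x₀`, at the fraction `ρ / (2 r)` of its length
from `x`. -/
lemma exists_ball_half_subset_inter_ball {E : Type*} [NormedAddCommGroup E] [NormedSpace ℝ E]
    {x₀ x : E} {r ρ : ℝ} (hρ : 0 < ρ) (hρr : ρ ≤ 2 * r) (hx : x ∈ ball x₀ r) :
    ∃ z, ball z (ρ / 2) ⊆ ball x₀ r ∩ ball x ρ := by
  have hr : 0 < r := by linarith
  obtain ⟨q, hq⟩ : ∃ q, q = ρ / (2 * r) := ⟨_, rfl⟩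
  have hq0 : 0 ≤ q := by rw [hq]; positivity
  have hq1 : q ≤ 1 := by rw [hq, div_le_one (by positivity)]; exact hρr
  have hqr : q * r = ρ / 2 := by rw [hq]; field_simp
  have hxr : ‖x₀ - x‖ ≤ r := by rw [← dist_eq_norm']; exact (mem_ball.1 hx).le
  have hqx : q * ‖x₀ - x‖ ≤ ρ / 2 := hqr ▸ mul_le_mul_of_nonneg_left hxr hq0
  refine ⟨AffineMap.lineMap x x₀ q, Set.subset_inter ?_ ?_⟩ <;> apply ball_subset_ball'
  · rw [dist_lineMap_right, Real.norm_of_nonneg (by linarith), dist_eq_norm']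
    nlinarith
  · rw [dist_lineMap_left, Real.norm_of_nonneg hq0, dist_eq_norm']
    linarith

lemma ball_subset_of_le_infDist_frontier {E : Type*} [NormedAddCommGroup E] [NormedSpace ℝ E]
    [FiniteDimensional ℝ E] {Ω : Set E} {x : E} {r : ℝ} (hx : x ∈ Ω)
    (hr : r ≤ infDist x (frontier Ω)) : ball x r ⊆ Ω := by
  rcases eq_or_ne Ω Set.univ with rfl | hΩ
  · exact Set.subset_univ _
  · obtain ⟨y, hy, hxy⟩ := exists_mem_frontier_infDist_compl_eq_dist hx hΩ
    refine (ball_subset_ball (hr.trans ?_)).trans ball_infDist_compl_subset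
    exact hxy ▸ infDist_le_dist_of_mem hy

lemma infDist_frontier_pos {X : Type*} [PseudoMetricSpace X] [PreconnectedSpace X] {Ω : Set X}
    (hΩ : IsOpen Ω) (hne : Ω ≠ Set.univ) {x : X} (hx : x ∈ Ω) : 0 < infDist x (frontier Ω) := by
  have hfr : (frontier Ω).Nonempty := nonempty_frontier_iff.2 ⟨⟨x, hx⟩, hne⟩
  refine (isClosed_frontier.notMem_iff_infDist_pos hfr).1 fun hxΩ => ?_
  exact (hΩ.frontier_eq ▸ hxΩ).2 hx

lemma le_ofReal_div_mul {a b : ℝ} {X Y : ℝ≥0∞} (ha : 0 < a)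
    (h : ENNReal.ofReal a * X ≤ ENNReal.ofReal b * Y) : X ≤ ENNReal.ofReal (b / a) * Y := by
  rwa [ENNReal.ofReal_div_of_pos ha, ← ENNReal.mul_div_right_comm,
    ENNReal.le_div_iff_mul_le (Or.inl (by simpa using ha)) (Or.inl ENNReal.ofReal_ne_top), mul_comm]

section Measure

variable {α : Type*} [MeasurableSpace α] {μ : Measure α} {f : α → ℝ} {p κ m : ℝ}

lemma ae_restrict_of_forall_mem_nhds [TopologicalSpace α] [SecondCountableTopology α] {S : Set α}
    (hS : MeasurableSet S) {P : α → Prop}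
    (h : ∀ y ∈ S, ∃ V ∈ 𝓝 y, ∀ᵐ x ∂μ.restrict V, P x) : ∀ᵐ x ∂μ.restrict S, P x := by
  rw [ae_iff, Measure.restrict_apply' hS]
  refine measure_null_of_locally_null _ fun y hy => ?_
  obtain ⟨V, hV, hPV⟩ := h y hy.2
  refine ⟨{x | ¬P x} ∩ V, ?_, nonpos_iff_eq_zero.1 ((Measure.le_restrict_apply _ _).trans hPV.le)⟩
  filter_upwards [self_mem_nhdsWithin, mem_nhdsWithin_of_mem_nhds hV] with x hxS hxV
  exact ⟨hxS.1, hxV⟩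

lemma eLpNorm_ofReal_rpow (hp : 0 < p) (f : α → ℝ) (μ : Measure α) :
    eLpNorm f (ENNReal.ofReal p) μ ^ p = ∫⁻ x, ‖f x‖ₑ ^ p ∂μ := by
  rw [eLpNorm_eq_lintegral_rpow_enorm_toReal (by simpa using hp) ENNReal.ofReal_ne_top,
    ENNReal.toReal_ofReal hp.le, one_div, ENNReal.rpow_inv_rpow hp.ne']

lemma enorm_max_zero (a : ℝ) : ‖max a 0‖ₑ = ENNReal.ofReal a := by
  simp [Real.enorm_of_nonneg]

lemma measure_lt_le_lintegral_rpow (hp : 0 < p) (hf : AEMeasurable f μ) (hm : 0 < m) :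
    μ {x | κ + m < f x} ≤
      ENNReal.ofReal (m ^ (-p)) * ∫⁻ x, ENNReal.ofReal (f x - κ) ^ p ∂μ := by
  have hsub : {x | κ + m < f x} ⊆
      {x | ENNReal.ofReal (m ^ p) ≤ ENNReal.ofReal (f x - κ) ^ p} := fun x hx => by
    rw [Set.mem_ofPred_eq] at hx ⊢
    rw [← ENNReal.ofReal_rpow_of_nonneg hm.le hp.le]
    gcongr
    linarith
  calc μ {x | κ + m < f x}
      ≤ (∫⁻ x, ENNReal.ofReal (f x - κ) ^ p ∂μ) / ENNReal.ofReal (m ^ p) :=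
        (measure_mono hsub).trans (meas_ge_le_lintegral_div (by fun_prop)
          (by simpa using Real.rpow_pos_of_pos hm p) ENNReal.ofReal_ne_top)
    _ = _ := by
        rw [ENNReal.div_eq_inv_mul, ← ENNReal.ofReal_inv_of_pos (by positivity),
          Real.rpow_neg hm.le]

lemma lintegral_ofReal_sub_add_le (hp : 1 ≤ p) (hm : 0 < m) :
    ∫⁻ x, ENNReal.ofReal (f x - (κ + m)) ∂μ ≤
      ENNReal.ofReal (m ^ (-(p - 1))) * ∫⁻ x, ENNReal.ofReal (f x - κ) ^ p ∂μ := by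
  rw [← lintegral_const_mul' _ _ ENNReal.ofReal_ne_top]
  refine lintegral_mono fun x => ?_
  rcases le_total (f x) (κ + m) with h | h
  · rw [ENNReal.ofReal_of_nonpos (by linarith)]
    exact zero_le
  · have h0 : 0 < f x - κ := by linarith
    rw [ENNReal.ofReal_rpow_of_pos h0, ← ENNReal.ofReal_mul (by positivity)]
    refine ENNReal.ofReal_le_ofReal ?_
    calc f x - (κ + m) ≤ f x - κ := by linarith
      _ = (f x - κ) ^ (-(p - 1)) * (f x - κ) ^ p := by
          rw [← Real.rpow_add h0, neg_sub, sub_add_cancel, Real.rpow_one]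
      _ ≤ m ^ (-(p - 1)) * (f x - κ) ^ p := by
          gcongr ?_ * _
          exact Real.rpow_le_rpow_of_nonpos hm (by linarith) (by linarith)

lemma laverage_rpow_le_rpow_laverage {q : ℝ} (hq : 0 < q) (hqp : q ≤ p) {g : α → ℝ}
    [IsFiniteMeasure μ] (hg : AEStronglyMeasurable g μ) :
    ⨍⁻ x, ‖g x‖ₑ ^ q ∂μ ≤ (⨍⁻ x, ‖g x‖ₑ ^ p ∂μ) ^ (q / p) := by
  rcases eq_zero_or_neZero μ with rfl | hμ
  · simp
  have hmono := eLpNorm'_le_eLpNorm'_of_exponent_le hq hqp ((μ Set.univ)⁻¹ • μ) (hg.smul_measure _)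
  have hpow := ENNReal.rpow_le_rpow hmono hq.le
  rwa [eLpNorm'_eq_lintegral_enorm, eLpNorm'_eq_lintegral_enorm, ← ENNReal.rpow_mul,
    ← ENNReal.rpow_mul, one_div_mul_cancel hq.ne', ENNReal.rpow_one, one_div_mul_eq_div] at hpow

lemma ae_ofReal_le_mul_of_forall_ae_le {C : ℝ≥0} {B : ℝ≥0∞} (hC : C ≠ 0)
    (h : ∀ t : ℝ, 0 < t → B ≤ ENNReal.ofReal t → ∀ᵐ x ∂μ, f x ≤ C * t) :
    ∀ᵐ x ∂μ, ENNReal.ofReal (f x) ≤ C * B := by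
  rcases eq_or_ne B ∞ with rfl | hB
  · simp [ENNReal.mul_top, hC]
  have hle (m : ℕ) : ∀ᵐ x ∂μ, f x ≤ C * (B.toReal + 1 / ((m : ℝ) + 1)) := by
    refine h _ (by positivity) ((ENNReal.le_ofReal_iff_toReal_le hB (by positivity)).2 ?_)
    exact le_add_of_nonneg_right (by positivity)
  filter_upwards [ae_all_iff.2 hle] with x hx
  have hlim : f x ≤ C * (B.toReal + 0) :=
    ge_of_tendsto' ((tendsto_one_div_add_atTop_nhds_zero_nat.const_add _).const_mul _) hx
  calc ENNReal.ofReal (f x) ≤ ENNReal.ofReal (C * B.toReal) :=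
        ENNReal.ofReal_le_ofReal (by rwa [add_zero] at hlim)
    _ = C * B := by
        rw [ENNReal.ofReal_mul C.coe_nonneg, ENNReal.ofReal_coe_nnreal, ENNReal.ofReal_toReal hB]

lemma essSup_coe_le_of_ae_ofReal_le {B : ℝ≥0∞} (h : ∀ᵐ x ∂μ, ENNReal.ofReal (f x) ≤ B) :
    essSup (fun x => (f x : EReal)) μ ≤ (B : EReal) := by
  refine essSup_le_of_ae_le _ (h.mono fun x hx => ?_)
  calc (f x : EReal) ≤ ((max (f x) 0 : ℝ) : EReal) := EReal.coe_le_coe_iff.2 (le_max_left _ _)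
    _ = (ENNReal.ofReal (f x) : EReal) := EReal.coe_ennreal_ofReal.symm
    _ ≤ B := EReal.coe_ennreal_le_coe_ennreal_iff.2 hx

end Measure

lemma exists_forall_tendsto_zero_of_le_mul_pow_mul_rpow (C b : ℝ≥0) {β : ℝ} (hβ : 0 < β) :
    ∃ ε : ℝ≥0, 0 < ε ∧ ∀ Y : ℕ → ℝ≥0∞, Y 0 ≤ ε →
      (∀ j, Y (j + 1) ≤ C * b ^ j * Y j ^ (1 + β)) → Tendsto Y atTop (𝓝 0) := by
  obtain ⟨θ, hθ0, hθ1, hbθ⟩ : ∃ θ : ℝ≥0, 0 < θ ∧ θ < 1 ∧ b * θ ^ β ≤ 1 := by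
    refine ⟨(2 * (b + 1))⁻¹ ^ β⁻¹, by positivity, NNReal.rpow_lt_one ?_ (by positivity), ?_⟩
    · exact inv_lt_one_of_one_lt₀ (by nlinarith [zero_le (a := b)])
    · rw [NNReal.rpow_inv_rpow hβ.ne', ← div_eq_mul_inv]
      exact div_le_one_of_le₀ (by nlinarith [zero_le (a := b)]) zero_le
  obtain ⟨ε, hε0, hCε⟩ : ∃ ε : ℝ≥0, 0 < ε ∧ C * ε ^ β ≤ θ := by
    refine ⟨(θ / (C + 1)) ^ β⁻¹, by positivity, ?_⟩
    rw [NNReal.rpow_inv_rpow hβ.ne', mul_div_left_comm]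
    exact mul_le_of_le_one_right' (div_le_one_of_le₀ le_self_add zero_le)
  refine ⟨ε, hε0, fun Y hY0 hY => ?_⟩
  have hdecay : ∀ j, Y j ≤ (ε * θ ^ j : ℝ≥0) := fun j => by
    induction j with
    | zero => simpa using hY0
    | succ j ih =>
      have hcomm : (θ ^ j) ^ β = (θ ^ β) ^ j := by
        rw [← NNReal.rpow_natCast, ← NNReal.rpow_natCast, ← NNReal.rpow_mul, ← NNReal.rpow_mul,
          mul_comm]
      have hreal : C * b ^ j * (ε * θ ^ j) ^ (1 + β) ≤ ε * θ ^ (j + 1) := calc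
        C * b ^ j * (ε * θ ^ j) ^ (1 + β)
          = C * ε ^ β * (b * θ ^ β) ^ j * (ε * θ ^ j) := by
            rw [NNReal.rpow_add' (by positivity), NNReal.rpow_one, NNReal.mul_rpow, mul_pow,
              hcomm]
            ring
        _ ≤ θ * 1 * (ε * θ ^ j) := by
            gcongr
            exact pow_le_one' hbθ j
        _ = ε * θ ^ (j + 1) := by ring
      calc Y (j + 1) ≤ C * b ^ j * Y j ^ (1 + β) := hY j
        _ ≤ C * b ^ j * (ε * θ ^ j : ℝ≥0) ^ (1 + β) := by gcongr
        _ ≤ (ε * θ ^ (j + 1) : ℝ≥0) := by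
            rw [← ENNReal.coe_rpow_of_nonneg _ (by positivity)]
            exact_mod_cast hreal
  refine tendsto_of_tendsto_of_tendsto_of_le_of_le tendsto_const_nhds ?_ (fun _ => zero_le) hdecay
  have hgeom := (tendsto_pow_atTop_nhds_zero_of_lt_one zero_le hθ1).const_mul ε
  rw [mul_zero] at hgeom
  exact ENNReal.tendsto_coe.2 hgeom

lemma exists_one_le_and_le_rpow {p ε : ℝ} (hp : 1 < p) (hε : 0 < ε) (a b : ℝ) :
    ∃ C : ℝ≥0, 1 ≤ C ∧ a ≤ (C : ℝ) ^ (p - 1) ∧ b ≤ (C : ℝ) ^ p * ε := by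
  have hp0 : 0 < p := by linarith
  obtain ⟨C, hC, hCa, hCb⟩ := ((eventually_ge_atTop 1).and
    (((tendsto_rpow_atTop (sub_pos.2 hp)).eventually_ge_atTop a).and
      (((tendsto_rpow_atTop hp0).atTop_mul_const hε).eventually_ge_atTop b))).exists
  exact ⟨⟨C, zero_le_one.trans hC⟩, hC, hCa, hCb⟩

lemma enorm_le_of_ofReal_le {a : ℝ} {B : ℝ≥0∞} (hpos : ENNReal.ofReal a ≤ B)
    (hneg : ENNReal.ofReal (-a) ≤ B) : ‖a‖ₑ ≤ B := by
  rw [Real.enorm_eq_ofReal_abs, abs, ENNReal.ofReal_max]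
  exact max_le hpos hneg

lemma div_rpow_le_ofReal_rpow_mul_div_rpow {c N : ℝ} (hc : 0 < c) (hN : 0 ≤ N) (a : ℝ≥0∞)
    {X Y : ℝ≥0∞} (h : Y ≤ ENNReal.ofReal c * X) :
    a / X ^ N ≤ ENNReal.ofReal (c ^ N) * (a / Y ^ N) := by
  have hcN : ENNReal.ofReal (c ^ N) ≠ 0 := by simpa using Real.rpow_pos_of_pos hc N
  calc a / X ^ N = ENNReal.ofReal (c ^ N) * a / (ENNReal.ofReal (c ^ N) * X ^ N) :=
        (ENNReal.mul_div_mul_left _ _ hcN ENNReal.ofReal_ne_top).symm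
    _ ≤ ENNReal.ofReal (c ^ N) * a / Y ^ N := by
        gcongr
        rw [← ENNReal.ofReal_rpow_of_nonneg hc.le hN, ← ENNReal.mul_rpow_of_nonneg _ _ hN]
        gcongr
    _ = ENNReal.ofReal (c ^ N) * (a / Y ^ N) := mul_div_assoc _ _ _

variable {n : ℕ} {s p : ℝ} {u v w : EuclideanSpace ℝ (Fin n) → ℝ}
  {A Ω : Set (EuclideanSpace ℝ (Fin n))} {x₀ x y : EuclideanSpace ℝ (Fin n)}
  {r R ρ d H lam κ k m σ r₁ r₂ : ℝ}

/-- The volume of the unit ball of `ℝⁿ`, the constant in `|B_r| = unitBallVolume n * r ^ n`. -/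
noncomputable def unitBallVolume (n : ℕ) : ℝ :=
  volume.real (ball (0 : EuclideanSpace ℝ (Fin n)) 1)

lemma unitBallVolume_pos (n : ℕ) : 0 < unitBallVolume n :=
  ENNReal.toReal_pos (measure_ball_pos _ _ one_pos).ne' measure_ball_lt_top.ne

lemma volume_ball_eq (x : EuclideanSpace ℝ (Fin n)) (hr : 0 < r) :
    volume (ball x r) = ENNReal.ofReal (unitBallVolume n * r ^ n) := by
  rw [Measure.addHaar_ball_of_pos volume x hr, finrank_euclideanSpace_fin, mul_comm,
    ENNReal.ofReal_mul (unitBallVolume_pos n).le, unitBallVolume, ofReal_measureReal]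

lemma gagliardoSeminorm_rpow (hp : 0 < p) (v : EuclideanSpace ℝ (Fin n) → ℝ)
    (U : Set (EuclideanSpace ℝ (Fin n))) :
    gagliardoSeminorm s p v U ^ p =
      ∫⁻ x in U, ∫⁻ y in U, ‖v x - v y‖ₑ ^ p / ‖x - y‖ₑ ^ ((n : ℝ) + s * p) := by
  rw [gagliardoSeminorm, one_div, ENNReal.rpow_inv_rpow hp.ne']

lemma volume_ball_half_le_two_mul_volume_diff (hρ : 0 < ρ) (hρr : ρ ≤ 2 * r) (hx : x ∈ ball x₀ r)
    (hA : 2 * volume (A ∩ ball x₀ r) ≤ volume (ball x₀ (ρ / 2))) :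
    volume (ball x₀ (ρ / 2)) ≤ 2 * volume ((ball x₀ r ∩ ball x ρ) \ A) := by
  obtain ⟨z, hz⟩ := exists_ball_half_subset_inter_ball hρ hρr hx
  have hcover : ball z (ρ / 2) ⊆ ((ball x₀ r ∩ ball x ρ) \ A) ∪ (A ∩ ball x₀ r) := fun y hy => by
    by_cases hyA : y ∈ A
    · exact Or.inr ⟨hyA, (hz hy).1⟩
    · exact Or.inl ⟨hz hy, hyA⟩
  have hsum : volume (ball x₀ (ρ / 2)) ≤
      volume ((ball x₀ r ∩ ball x ρ) \ A) + volume (A ∩ ball x₀ r) := by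
    rw [volume_ball_eq x₀ (half_pos hρ), ← volume_ball_eq z (half_pos hρ)]
    exact (measure_mono hcover).trans (measure_union_le _ _)
  refine (ENNReal.add_le_add_iff_right (measure_ball_lt_top (μ := volume)
    (x := x₀) (r := ρ / 2)).ne).1 ?_
  calc volume (ball x₀ (ρ / 2)) + volume (ball x₀ (ρ / 2))
      = 2 * volume (ball x₀ (ρ / 2)) := (two_mul _).symm
    _ ≤ 2 * (volume ((ball x₀ r ∩ ball x ρ) \ A) + volume (A ∩ ball x₀ r)) := by gcongr
    _ ≤ 2 * volume ((ball x₀ r ∩ ball x ρ) \ A) + volume (ball x₀ (ρ / 2)) := by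
        rw [mul_add]
        gcongr

/-- Only pairs `(x, y)` with `v y = 0` and `‖x - y‖ < ρ` are used to bound the seminorm below. -/
lemma volume_ball_mul_lintegral_rpow_le_gagliardoSeminorm (hp : 0 < p) (hs : 0 ≤ s)
    (hA : NullMeasurableSet A) (hv : ∀ y ∉ A, v y = 0) (hρ : 0 < ρ) (hρr : ρ ≤ 2 * r)
    (hvol : 2 * volume (A ∩ ball x₀ r) ≤ volume (ball x₀ (ρ / 2))) :
    volume (ball x₀ (ρ / 2)) * ∫⁻ x in ball x₀ r, ‖v x‖ₑ ^ p ≤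
      ENNReal.ofReal (2 * ρ ^ ((n : ℝ) + s * p)) * gagliardoSeminorm s p v (ball x₀ r) ^ p := by
  have hN : 0 ≤ (n : ℝ) + s * p := by positivity
  rw [gagliardoSeminorm_rpow hp, ← lintegral_const_mul' _ _ measure_ball_lt_top.ne,
    ← lintegral_const_mul' _ _ ENNReal.ofReal_ne_top]
  refine setLIntegral_mono' measurableSet_ball fun x hx => ?_
  have hS : NullMeasurableSet ((ball x₀ r ∩ ball x ρ) \ A) :=
    (measurableSet_ball.inter measurableSet_ball).nullMeasurableSet.diff hA
  have hpt : ∀ y ∈ (ball x₀ r ∩ ball x ρ) \ A, ‖v x‖ₑ ^ p ≤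
      ENNReal.ofReal (ρ ^ ((n : ℝ) + s * p)) *
        (‖v x - v y‖ₑ ^ p / ‖x - y‖ₑ ^ ((n : ℝ) + s * p)) := fun y hy => by
    have hxy : ‖x - y‖ₑ ≤ ENNReal.ofReal ρ := by
      rw [← ofReal_norm, ← dist_eq_norm, dist_comm]
      exact ENNReal.ofReal_le_ofReal (mem_ball.1 hy.1.2).le
    have hρN : ENNReal.ofReal (ρ ^ ((n : ℝ) + s * p)) ≠ 0 := by
      simpa using Real.rpow_pos_of_pos hρ _
    rw [hv y hy.2, sub_zero]
    calc ‖v x‖ₑ ^ p = ENNReal.ofReal (ρ ^ ((n : ℝ) + s * p)) *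
          (‖v x‖ₑ ^ p / ENNReal.ofReal (ρ ^ ((n : ℝ) + s * p))) :=
          (ENNReal.mul_div_cancel hρN ENNReal.ofReal_ne_top).symm
      _ ≤ _ := by
          rw [← ENNReal.ofReal_rpow_of_nonneg hρ.le hN]
          gcongr
  calc volume (ball x₀ (ρ / 2)) * ‖v x‖ₑ ^ p
      ≤ 2 * ∫⁻ _ in (ball x₀ r ∩ ball x ρ) \ A, ‖v x‖ₑ ^ p := by
        rw [setLIntegral_const, mul_comm (‖v x‖ₑ ^ p), ← mul_assoc]
        gcongr
        exact volume_ball_half_le_two_mul_volume_diff hρ hρr hx hvol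
    _ ≤ 2 * ∫⁻ y in (ball x₀ r ∩ ball x ρ) \ A, ENNReal.ofReal (ρ ^ ((n : ℝ) + s * p)) *
          (‖v x - v y‖ₑ ^ p / ‖x - y‖ₑ ^ ((n : ℝ) + s * p)) := by
        gcongr 2 * ?_
        exact lintegral_mono_ae ((ae_restrict_iff'₀ hS).2 (ae_of_all _ hpt))
    _ ≤ ENNReal.ofReal (2 * ρ ^ ((n : ℝ) + s * p)) *
          ∫⁻ y in ball x₀ r, ‖v x - v y‖ₑ ^ p / ‖x - y‖ₑ ^ ((n : ℝ) + s * p) := by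
        rw [lintegral_const_mul' _ _ ENNReal.ofReal_ne_top, ENNReal.ofReal_mul zero_le_two,
          ENNReal.ofReal_ofNat, mul_assoc]
        gcongr
        exact Set.sdiff_subset.trans Set.inter_subset_left

/-- For `ρ > 2 r` the second term on the right alone exceeds the left-hand side. -/
lemma lintegral_rpow_le_rpow_mul (hp : 0 < p) (hs : 0 ≤ s) (hA : NullMeasurableSet A)
    (hv : ∀ y ∉ A, v y = 0) (hr : 0 < r) (hρ : 0 < ρ)
    (hvol : 2 * volume (A ∩ ball x₀ r) ≤ volume (ball x₀ (ρ / 2))) :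
    ∫⁻ x in ball x₀ r, ‖v x‖ₑ ^ p ≤
      ENNReal.ofReal ((2 ^ (n + 1) / unitBallVolume n + 1) * ρ ^ (s * p)) *
        (gagliardoSeminorm s p v (ball x₀ r) ^ p +
          ENNReal.ofReal (r ^ (-(s * p))) * ∫⁻ x in ball x₀ r, ‖v x‖ₑ ^ p) := by
  have hω := unitBallVolume_pos n
  have hρs : 0 < ρ ^ (s * p) := by positivity
  rcases le_or_gt ρ (2 * r) with hρr | hρr
  · have hV : 0 < unitBallVolume n * (ρ / 2) ^ n := by positivity
    have h := volume_ball_mul_lintegral_rpow_le_gagliardoSeminorm hp hs hA hv hρ hρr hvol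
    rw [volume_ball_eq x₀ (half_pos hρ)] at h
    refine (le_ofReal_div_mul hV h).trans (mul_le_mul' (ENNReal.ofReal_le_ofReal ?_) le_self_add)
    calc 2 * ρ ^ ((n : ℝ) + s * p) / (unitBallVolume n * (ρ / 2) ^ n)
        = 2 ^ (n + 1) / unitBallVolume n * ρ ^ (s * p) := by
          rw [Real.rpow_add hρ, Real.rpow_natCast, div_pow]
          field_simp
          ring
      _ ≤ (2 ^ (n + 1) / unitBallVolume n + 1) * ρ ^ (s * p) := by gcongr; linarith
  · refine le_trans ?_ (mul_le_mul_right le_add_self _)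
    rw [← mul_assoc, ← ENNReal.ofReal_mul (by positivity)]
    refine le_mul_of_one_le_left' (ENNReal.one_le_ofReal.2 ?_)
    have hrs : r ^ (s * p) ≤ ρ ^ (s * p) := by gcongr; linarith
    rw [Real.rpow_neg hr.le, ← div_eq_mul_inv, one_le_div (by positivity)]
    exact hrs.trans (le_mul_of_one_le_left hρs.le (le_add_of_nonneg_left (by positivity)))

lemma exists_lintegral_rpow_le_volume_rpow_mul (hn : 1 ≤ n) (hp : 0 < p) (hs : 0 < s) :
    ∃ C : ℝ≥0, ∀ (v : EuclideanSpace ℝ (Fin n) → ℝ) (A : Set (EuclideanSpace ℝ (Fin n)))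
      (x₀ : EuclideanSpace ℝ (Fin n)) (r : ℝ), NullMeasurableSet A → (∀ y ∉ A, v y = 0) → 0 < r →
      ∫⁻ x in ball x₀ r, ‖v x‖ₑ ^ p ≤ C * volume (A ∩ ball x₀ r) ^ (s * p / n) *
        (gagliardoSeminorm s p v (ball x₀ r) ^ p +
          ENNReal.ofReal (r ^ (-(s * p))) * ∫⁻ x in ball x₀ r, ‖v x‖ₑ ^ p) := by
  have hω := unitBallVolume_pos n
  refine ⟨((2 ^ (n + 1) / unitBallVolume n + 1) *
    (2 ^ (s * p) * (2 / unitBallVolume n) ^ (s * p / n))).toNNReal, ?_⟩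
  intro v A x₀ r hA hv hr
  rcases eq_or_ne (volume (A ∩ ball x₀ r)) 0 with ha | ha
  · have hvA : ∫⁻ x in ball x₀ r, ‖v x‖ₑ ^ p = 0 := by
      refine lintegral_eq_zero_of_ae_eq_zero ((ae_restrict_iff' measurableSet_ball).2 ?_)
      filter_upwards [measure_eq_zero_iff_ae_notMem.1 ha] with x hxA hx
      simp [hv x fun h => hxA ⟨h, hx⟩, hp]
    simp [hvA]
  obtain ⟨a, ha0, haeq⟩ : ∃ a : ℝ, 0 < a ∧ volume (A ∩ ball x₀ r) = ENNReal.ofReal a := by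
    have hfin : volume (A ∩ ball x₀ r) ≠ ∞ :=
      measure_ne_top_of_subset Set.inter_subset_right measure_ball_lt_top.ne
    exact ⟨_, ENNReal.toReal_pos ha hfin, (ENNReal.ofReal_toReal hfin).symm⟩
  obtain ⟨ρ, hρ⟩ : ∃ ρ, ρ = 2 * (2 / unitBallVolume n * a) ^ (n : ℝ)⁻¹ := ⟨_, rfl⟩
  have hρ0 : 0 < ρ := by rw [hρ]; positivity
  have hvol : 2 * volume (A ∩ ball x₀ r) = volume (ball x₀ (ρ / 2)) := by
    rw [volume_ball_eq x₀ (half_pos hρ0), haeq, ← ENNReal.ofReal_ofNat, ← ENNReal.ofReal_mul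
      zero_le_two, hρ, mul_div_cancel_left₀ _ two_ne_zero,
      Real.rpow_inv_natCast_pow (by positivity) (by omega)]
    field_simp
  have hρs : ρ ^ (s * p) =
      2 ^ (s * p) * (2 / unitBallVolume n) ^ (s * p / n) * a ^ (s * p / n) := by
    rw [hρ, Real.mul_rpow zero_le_two (by positivity), ← Real.rpow_mul (by positivity),
      Real.mul_rpow (by positivity) ha0.le, inv_mul_eq_div, mul_assoc]
  refine (lintegral_rpow_le_rpow_mul hp hs.le hA hv hr hρ0 hvol.le).trans_eq ?_
  rw [hρs, haeq, ENNReal.ofReal_rpow_of_pos ha0, ← ENNReal.ofReal_coe_nnreal,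
    Real.coe_toNNReal _ (by positivity), ← ENNReal.ofReal_mul (by positivity)]
  simp only [mul_assoc]

/-- The `p`-th power of the `L^p(B_r(x₀))` norm of the truncation `(u - κ)₊`. -/
noncomputable def energy (p : ℝ) (u : EuclideanSpace ℝ (Fin n) → ℝ) (κ : ℝ)
    (x₀ : EuclideanSpace ℝ (Fin n)) (r : ℝ) : ℝ≥0∞ :=
  ∫⁻ x in ball x₀ r, ENNReal.ofReal (u x - κ) ^ p

lemma energy_mono {κ' r' : ℝ} (hp : 0 ≤ p) (hκ : κ' ≤ κ) (hr : r ≤ r') :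
    energy p u κ x₀ r ≤ energy p u κ' x₀ r' := by
  unfold energy
  gcongr

/-- The unnormalized tail: `Tail_{s,p}(v; x₀, r) ^ (p - 1)` without the factor `r ^ (s p)`. -/
noncomputable def tailIntegral (s p : ℝ) (v : EuclideanSpace ℝ (Fin n) → ℝ)
    (x₀ : EuclideanSpace ℝ (Fin n)) (r : ℝ) : ℝ≥0∞ :=
  ∫⁻ x in (ball x₀ r)ᶜ, ‖v x‖ₑ ^ (p - 1) / ‖x - x₀‖ₑ ^ ((n : ℝ) + s * p)

lemma tailIntegral_mono {r' : ℝ} (hp : 1 ≤ p) (h : ∀ x, ‖v x‖ₑ ≤ ‖w x‖ₑ) (hr : r' ≤ r) :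
    tailIntegral s p v x₀ r ≤ tailIntegral s p w x₀ r' := by
  have : 0 ≤ p - 1 := by linarith
  unfold tailIntegral
  gcongr
  exact h _

lemma tail_rpow (hp : 1 < p) (v : EuclideanSpace ℝ (Fin n) → ℝ)
    (x₀ : EuclideanSpace ℝ (Fin n)) (R : ℝ) :
    tail s p v x₀ R ^ (p - 1) = ENNReal.ofReal (R ^ (s * p)) * tailIntegral s p v x₀ R := by
  rw [tail, tailIntegral, one_div, ENNReal.rpow_inv_rpow (by linarith)]

lemma tailBar_rpow (hp : 1 < p) (v : EuclideanSpace ℝ (Fin n) → ℝ)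
    (x₀ : EuclideanSpace ℝ (Fin n)) (hR : 0 < R) :
    tailBar s p v x₀ R ^ (p - 1) = tailIntegral s p v x₀ R := by
  have hp1 : 0 < p - 1 := by linarith
  rw [tailBar, ENNReal.mul_rpow_of_nonneg _ _ hp1.le, tail_rpow hp, ← mul_assoc,
    ENNReal.ofReal_rpow_of_nonneg (by positivity) hp1.le, ← ENNReal.ofReal_mul (by positivity),
    ← Real.rpow_mul hR.le, neg_mul, div_mul_cancel₀ _ hp1.ne', ← Real.rpow_add hR,
    neg_add_cancel, Real.rpow_zero, ENNReal.ofReal_one, one_mul]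

/-- The level `k` dominates, at scale `R`, the two contributions to the Caccioppoli inequality that
are not given by local energies: the datum `d` and the tail of `u₊`. -/
structure IsDominatingLevel (s p d lam : ℝ) (u : EuclideanSpace ℝ (Fin n) → ℝ)
    (x₀ : EuclideanSpace ℝ (Fin n)) (R k : ℝ) : Prop where
  pos : 0 < k
  datum_le : R ^ lam * d ^ p ≤ R ^ (-(s * p)) * k ^ p
  tailIntegral_le : tailIntegral s p (fun x => max (u x) 0) x₀ (R / 2) ≤
    ENNReal.ofReal (R ^ (-(s * p)) * k ^ (p - 1))

/-- The admissible parameters of one step of De Giorgi's iteration inside `B_R`: the radius drops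
from `r₂` to `r₁` and the level rises by `m`, both by at least the proportion `σ` of the reference
scales `R` and `k`. -/
structure IsStep (R k σ r₁ r₂ m : ℝ) : Prop where
  radius_pos : 0 < R
  ratio_pos : 0 < σ
  ratio_le_one : σ ≤ 1
  half_le : R / 2 ≤ r₁
  le_radius : r₂ ≤ R
  ratio_mul_radius_le : σ * R ≤ r₂ - r₁
  ratio_mul_level_le : σ * k ≤ m

namespace IsStep

lemma inner_pos (h : IsStep R k σ r₁ r₂ m) : 0 < r₁ := (half_pos h.radius_pos).trans_le h.half_le

lemma inner_lt_outer (h : IsStep R k σ r₁ r₂ m) : r₁ < r₂ :=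
  sub_pos.1 ((mul_pos h.ratio_pos h.radius_pos).trans_le h.ratio_mul_radius_le)

lemma outer_pos (h : IsStep R k σ r₁ r₂ m) : 0 < r₂ := h.inner_pos.trans h.inner_lt_outer

lemma level_gap_pos (h : IsStep R k σ r₁ r₂ m) (hk : 0 < k) : 0 < m :=
  (mul_pos h.ratio_pos hk).trans_le h.ratio_mul_level_le

end IsStep

lemma datum_mul_volume_le (hp : 0 < p) (hd : 0 ≤ d) (hlam : 0 ≤ lam) (hu : AEMeasurable u)
    (hk : IsDominatingLevel s p d lam u x₀ R k) (hstep : IsStep R k σ r₁ r₂ m) :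
    ENNReal.ofReal (r₂ ^ lam * d ^ p) * volume ({x | κ + m < u x} ∩ ball x₀ r₂) ≤
      ENNReal.ofReal (R ^ (-(s * p)) * σ ^ (-p)) * energy p u κ x₀ r₂ := by
  have hk0 := hk.pos
  have hR := hstep.radius_pos
  have hσ := hstep.ratio_pos
  have hr₂ := hstep.outer_pos
  rw [← Measure.restrict_apply' measurableSet_ball]
  refine (mul_le_mul_right (measure_lt_le_lintegral_rpow hp hu.restrict
    (hstep.level_gap_pos hk0)) _).trans ?_
  rw [← mul_assoc, ← ENNReal.ofReal_mul (by positivity)]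
  refine mul_le_mul_left (ENNReal.ofReal_le_ofReal ?_) _
  calc r₂ ^ lam * d ^ p * m ^ (-p) ≤ R ^ (-(s * p)) * k ^ p * (σ * k) ^ (-p) := by
        refine mul_le_mul (le_trans ?_ hk.datum_le) ?_ ?_ (by positivity)
        · gcongr
          exact hstep.le_radius
        · exact Real.rpow_le_rpow_of_nonpos (by positivity) hstep.ratio_mul_level_le (by linarith)
        · have := hstep.level_gap_pos hk0
          positivity
    _ = R ^ (-(s * p)) * σ ^ (-p) := by
        rw [Real.mul_rpow hσ.le hk0.le, Real.rpow_neg hk0.le]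
        field_simp

lemma radius_mul_eLpNorm_le (hp : 0 < p) (hs : 0 ≤ s) (hk : 0 < k)
    (hstep : IsStep R k σ r₁ r₂ m) :
    ENNReal.ofReal (r₂ ^ ((1 - s) * p) / (r₂ - r₁) ^ p) *
        eLpNorm (fun x => max (u x - (κ + m)) 0) (ENNReal.ofReal p)
          (volume.restrict (ball x₀ r₂)) ^ p ≤
      ENNReal.ofReal (2 ^ (s * p) * R ^ (-(s * p)) * σ ^ (-p)) * energy p u κ x₀ r₂ := by
  have hR := hstep.radius_pos
  have hσ := hstep.ratio_pos
  have hr₂ := hstep.outer_pos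
  have hm := hstep.level_gap_pos hk
  rw [eLpNorm_ofReal_rpow hp]
  simp only [enorm_max_zero]
  refine mul_le_mul' (ENNReal.ofReal_le_ofReal ?_) (energy_mono hp.le (by linarith) le_rfl)
  calc r₂ ^ ((1 - s) * p) / (r₂ - r₁) ^ p = r₂ ^ (-(s * p)) * r₂ ^ p / (r₂ - r₁) ^ p := by
        rw [← Real.rpow_add hr₂]
        ring_nf
    _ ≤ (R / 2) ^ (-(s * p)) * R ^ p / (σ * R) ^ p := by
        gcongr ?_ * ?_ / ?_
        · exact Real.rpow_le_rpow_of_nonpos (by positivity)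
            (hstep.half_le.trans hstep.inner_lt_outer.le) (neg_nonpos.2 (by positivity))
        · gcongr
          exact hstep.le_radius
        · gcongr
          exact hstep.ratio_mul_radius_le
    _ = 2 ^ (s * p) * R ^ (-(s * p)) * σ ^ (-p) := by
        rw [Real.mul_rpow hσ.le hR.le, Real.rpow_neg hσ.le, Real.div_rpow hR.le zero_le_two,
          Real.rpow_neg zero_le_two]
        field_simp

lemma eLpNorm_one_mul_tailBar_le (hp : 1 < p) (hs : 0 ≤ s) (hκ : 0 ≤ κ)
    (hk : IsDominatingLevel s p d lam u x₀ R k) (hstep : IsStep R k σ r₁ r₂ m) :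
    ENNReal.ofReal (r₂ ^ ((n : ℝ) + s * p) / (r₂ - r₁) ^ ((n : ℝ) + s * p)) *
        eLpNorm (fun x => max (u x - (κ + m)) 0) 1 (volume.restrict (ball x₀ r₂)) *
        tailBar s p (fun x => max (u x - (κ + m)) 0) x₀ r₁ ^ (p - 1) ≤
      ENNReal.ofReal (R ^ (-(s * p)) * σ ^ (-((n : ℝ) + s * p + (p - 1)))) *
        energy p u κ x₀ r₂ := by
  have hk0 := hk.pos
  have hR := hstep.radius_pos
  have hσ := hstep.ratio_pos
  have hr₂ := hstep.outer_pos
  have hm := hstep.level_gap_pos hk0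
  have hL1 : eLpNorm (fun x => max (u x - (κ + m)) 0) 1 (volume.restrict (ball x₀ r₂)) ≤
      ENNReal.ofReal (m ^ (-(p - 1))) * energy p u κ x₀ r₂ := by
    rw [eLpNorm_one_eq_lintegral_enorm]
    simp only [enorm_max_zero]
    exact lintegral_ofReal_sub_add_le hp.le hm
  have htail : tailBar s p (fun x => max (u x - (κ + m)) 0) x₀ r₁ ^ (p - 1) ≤
      ENNReal.ofReal (R ^ (-(s * p)) * k ^ (p - 1)) := by
    rw [tailBar_rpow hp _ _ hstep.inner_pos]
    refine (tailIntegral_mono hp.le (fun x => ?_) hstep.half_le).trans hk.tailIntegral_le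
    simp only [enorm_max_zero]
    exact ENNReal.ofReal_le_ofReal (by linarith)
  have hr := sub_pos.2 hstep.inner_lt_outer
  refine (mul_le_mul' (mul_le_mul_right hL1 _) htail).trans ?_
  rw [← mul_assoc, mul_right_comm, ← ENNReal.ofReal_mul (by positivity),
    ← ENNReal.ofReal_mul (by positivity)]
  refine mul_le_mul_left (ENNReal.ofReal_le_ofReal ?_) _
  calc r₂ ^ ((n : ℝ) + s * p) / (r₂ - r₁) ^ ((n : ℝ) + s * p) * m ^ (-(p - 1)) *
        (R ^ (-(s * p)) * k ^ (p - 1))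
      ≤ R ^ ((n : ℝ) + s * p) / (σ * R) ^ ((n : ℝ) + s * p) * (σ * k) ^ (-(p - 1)) *
        (R ^ (-(s * p)) * k ^ (p - 1)) := by
        gcongr ?_ / ?_ * ?_ * _
        · gcongr
          exact hstep.le_radius
        · gcongr
          exact hstep.ratio_mul_radius_le
        · exact Real.rpow_le_rpow_of_nonpos (by positivity) hstep.ratio_mul_level_le (by linarith)
    _ = R ^ (-(s * p)) * σ ^ (-((n : ℝ) + s * p + (p - 1))) := by
        rw [neg_add, Real.rpow_add hσ, Real.mul_rpow hσ.le hR.le, Real.mul_rpow hσ.le hk0.le,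
          Real.rpow_neg hσ.le (n + s * p), Real.rpow_neg hk0.le]
        field_simp

lemma CaccioppoliIneq.gagliardoSeminorm_rpow_le (hp : 1 < p) (hs : 0 ≤ s) (hd : 0 ≤ d)
    (hlam : 0 ≤ lam) (hu : AEMeasurable u) (hκ : 0 ≤ κ)
    (hk : IsDominatingLevel s p d lam u x₀ R k) (hstep : IsStep R k σ r₁ r₂ m)
    (h : CaccioppoliIneq s p d H lam (fun x => max (u x - (κ + m)) 0) {x | κ + m < u x} x₀ r₁ r₂) :
    gagliardoSeminorm s p (fun x => max (u x - (κ + m)) 0) (ball x₀ r₁) ^ p ≤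
      ENNReal.ofReal H * 3 *
        ENNReal.ofReal (2 ^ (s * p) * R ^ (-(s * p)) * σ ^ (-((n : ℝ) + s * p + p))) *
        energy p u κ x₀ r₂ := by
  have hR := hstep.radius_pos
  have hσ := hstep.ratio_pos
  have : (0 : ℝ) ≤ n := by positivity
  have hsp : 0 ≤ s * p := by positivity
  have h2 : (1 : ℝ) ≤ 2 ^ (s * p) := Real.one_le_rpow one_le_two hsp
  have hexp : ∀ a : ℝ, a ≤ (n : ℝ) + s * p + p → R ^ (-(s * p)) * σ ^ (-a) ≤
      2 ^ (s * p) * R ^ (-(s * p)) * σ ^ (-((n : ℝ) + s * p + p)) := fun a ha => by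
    gcongr ?_ * ?_
    · exact le_mul_of_one_le_left (by positivity) h2
    · exact Real.rpow_le_rpow_of_exponent_ge hσ hstep.ratio_le_one (by linarith)
  rw [mul_assoc, mul_assoc]
  refine LE.le.trans h (mul_le_mul_right ?_ _)
  rw [show (3 : ℝ≥0∞) = 1 + 1 + 1 by norm_num, add_mul, add_mul, one_mul]
  refine add_le_add (add_le_add
    ((datum_mul_volume_le (by linarith) hd hlam hu hk hstep).trans ?_)
    ((radius_mul_eLpNorm_le (by linarith) hs hk.pos hstep).trans ?_))
    ((eLpNorm_one_mul_tailBar_le hp hs hκ hk hstep).trans ?_)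
  · exact mul_le_mul_left (ENNReal.ofReal_le_ofReal (hexp p (by linarith))) _
  · gcongr ENNReal.ofReal (_ * ?_) * _
    exact Real.rpow_le_rpow_of_exponent_ge hσ hstep.ratio_le_one (by linarith)
  · exact mul_le_mul_left (ENNReal.ofReal_le_ofReal (hexp _ (by linarith))) _

/-- The energy of `(u - κ)₊` on `B_r(x₀)` in units of the reference scales `R` and `k`. -/
noncomputable def scaledEnergy (p : ℝ) (u : EuclideanSpace ℝ (Fin n) → ℝ)
    (x₀ : EuclideanSpace ℝ (Fin n)) (R k κ r : ℝ) : ℝ≥0∞ :=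
  energy p u κ x₀ r / ENNReal.ofReal (k ^ p * R ^ n)

lemma ofReal_mul_scaledEnergy (hR : 0 < R) (hk : 0 < k) (κ r : ℝ) :
    ENNReal.ofReal (k ^ p * R ^ n) * scaledEnergy p u x₀ R k κ r = energy p u κ x₀ r := by
  have hM : 0 < k ^ p * R ^ n := by positivity
  exact ENNReal.mul_div_cancel (by simpa using hM) ENNReal.ofReal_ne_top

lemma IsStep.volume_lt_inter_ball_le (hp : 0 < p) (hu : AEMeasurable u) (hk : 0 < k)
    (hstep : IsStep R k σ r₁ r₂ m) :
    volume ({x | κ + m < u x} ∩ ball x₀ r₁) ≤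
      ENNReal.ofReal (σ ^ (-p) * R ^ n) * scaledEnergy p u x₀ R k κ r₂ := by
  have hR := hstep.radius_pos
  have hσ := hstep.ratio_pos
  have hm := hstep.level_gap_pos hk
  calc volume ({x | κ + m < u x} ∩ ball x₀ r₁)
      ≤ ENNReal.ofReal (m ^ (-p)) * energy p u κ x₀ r₁ := by
        rw [← Measure.restrict_apply' measurableSet_ball]
        exact measure_lt_le_lintegral_rpow hp hu.restrict hm
    _ ≤ ENNReal.ofReal ((σ * k) ^ (-p)) * energy p u κ x₀ r₂ := by
        refine mul_le_mul' (ENNReal.ofReal_le_ofReal ?_)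
          (energy_mono hp.le le_rfl hstep.inner_lt_outer.le)
        exact Real.rpow_le_rpow_of_nonpos (by positivity) hstep.ratio_mul_level_le (by linarith)
    _ = ENNReal.ofReal (σ ^ (-p) * R ^ n) * scaledEnergy p u x₀ R k κ r₂ := by
        rw [← ofReal_mul_scaledEnergy hR hk, ← mul_assoc, ← ENNReal.ofReal_mul (by positivity),
          Real.mul_rpow hσ.le hk.le, Real.rpow_neg hk.le]
        congr 2
        field_simp

lemma MemWDGPlus.gagliardoSeminorm_rpow_add_le (hu : MemWDGPlus s p d H lam Ω u) (hp : 1 < p)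
    (hs : 0 ≤ s) (hd : 0 ≤ d) (hlam : 0 ≤ lam) (hx : x₀ ∈ Ω) (hR : R < infDist x₀ (frontier Ω))
    (hκ : 0 ≤ κ) (hk : IsDominatingLevel s p d lam u x₀ R k) (hstep : IsStep R k σ r₁ r₂ m) :
    gagliardoSeminorm s p (fun x => max (u x - (κ + m)) 0) (ball x₀ r₁) ^ p +
        ENNReal.ofReal (r₁ ^ (-(s * p))) * energy p u (κ + m) x₀ r₁ ≤
      (ENNReal.ofReal H * 3 + 1) *
        ENNReal.ofReal (2 ^ (s * p) * R ^ (-(s * p)) * σ ^ (-((n : ℝ) + s * p + p))) *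
        energy p u κ x₀ r₂ := by
  have hR0 := hstep.radius_pos
  have hσ := hstep.ratio_pos
  have hm := hstep.level_gap_pos hk.pos
  rw [add_mul, add_mul, one_mul]
  refine add_le_add ?_ (mul_le_mul' (ENNReal.ofReal_le_ofReal ?_)
    (energy_mono (by linarith) (by linarith) hstep.inner_lt_outer.le))
  · exact (hu.caccioppoli x₀ hx r₁ r₂ hstep.inner_pos hstep.inner_lt_outer
      (hstep.le_radius.trans_lt hR) (κ + m)).gagliardoSeminorm_rpow_le hp hs hd hlam
      hu.memTailSpace.1 hκ hk hstep
  · calc r₁ ^ (-(s * p)) ≤ (R / 2) ^ (-(s * p)) :=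
          Real.rpow_le_rpow_of_nonpos (by positivity) hstep.half_le
            (neg_nonpos.2 (by positivity))
      _ = 2 ^ (s * p) * R ^ (-(s * p)) := by
          rw [Real.div_rpow hR0.le zero_le_two, Real.rpow_neg zero_le_two]
          field_simp
      _ ≤ 2 ^ (s * p) * R ^ (-(s * p)) * σ ^ (-((n : ℝ) + s * p + p)) :=
          le_mul_of_one_le_right (by positivity)
            (Real.one_le_rpow_of_pos_of_le_one_of_nonpos hσ hstep.ratio_le_one
              (neg_nonpos.2 (by positivity)))

lemma exists_scaledEnergy_add_le (n : ℕ) (hn : 1 ≤ n) (s p H : ℝ) (hs : 0 < s) (hp : 1 < p) :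
    ∃ C : ℝ≥0, ∀ (Ω : Set (EuclideanSpace ℝ (Fin n))) (d lam : ℝ), 0 ≤ d → 0 ≤ lam →
      ∀ u, MemWDGPlus s p d H lam Ω u → ∀ x₀ ∈ Ω, ∀ R < infDist x₀ (frontier Ω), ∀ k,
      IsDominatingLevel s p d lam u x₀ R k → ∀ κ σ r₁ r₂ m, 0 ≤ κ → IsStep R k σ r₁ r₂ m →
      scaledEnergy p u x₀ R k (κ + m) r₁ ≤
        C * ENNReal.ofReal (σ ^ (-((n : ℝ) + s * p + p + p * (s * p / n)))) *
          scaledEnergy p u x₀ R k κ r₂ ^ (1 + s * p / n) := by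
  have hp0 : 0 < p := by linarith
  have hβ : 0 < s * p / n := by positivity
  obtain ⟨C, hC⟩ := exists_lintegral_rpow_le_volume_rpow_mul hn hp0 hs
  refine ⟨C * (H.toNNReal * 3 + 1) * (2 ^ (s * p) : ℝ).toNNReal, ?_⟩
  intro Ω d lam hd hlam u hu x₀ hx R hR k hk κ σ r₁ r₂ m hκ hstep
  have hk0 := hk.pos
  have hR0 := hstep.radius_pos
  have hσ := hstep.ratio_pos
  have hsobolev := hC (fun x => max (u x - (κ + m)) 0) {x | κ + m < u x} x₀ r₁
    (nullMeasurableSet_lt aemeasurable_const hu.memTailSpace.1)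
    (fun y hy => max_eq_right (sub_nonpos.2 (not_lt.1 hy))) hstep.inner_pos
  simp only [enorm_max_zero] at hsobolev
  have hscale : (σ ^ (-p) * R ^ n) ^ (s * p / n) *
      (2 ^ (s * p) * R ^ (-(s * p)) * σ ^ (-((n : ℝ) + s * p + p))) =
      2 ^ (s * p) * σ ^ (-((n : ℝ) + s * p + p + p * (s * p / n))) := by
    rw [Real.mul_rpow (by positivity) (by positivity), ← Real.rpow_natCast R n,
      ← Real.rpow_mul hR0.le, mul_div_cancel₀ _ (by positivity), ← Real.rpow_mul hσ.le,
      Real.rpow_neg hR0.le, neg_add _ (p * (s * p / n)), Real.rpow_add hσ, ← neg_mul]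
    field_simp
  refine ENNReal.div_le_of_le_mul ?_
  calc energy p u (κ + m) x₀ r₁
      ≤ C * (ENNReal.ofReal (σ ^ (-p) * R ^ n) * scaledEnergy p u x₀ R k κ r₂) ^ (s * p / n) *
        ((ENNReal.ofReal H * 3 + 1) *
          ENNReal.ofReal (2 ^ (s * p) * R ^ (-(s * p)) * σ ^ (-((n : ℝ) + s * p + p))) *
          energy p u κ x₀ r₂) := by
        refine hsobolev.trans (mul_le_mul' ?_
          (hu.gagliardoSeminorm_rpow_add_le hp hs.le hd hlam hx hR hκ hk hstep))
        gcongr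
        exact hstep.volume_lt_inter_ball_le hp0 hu.memTailSpace.1 hk0
    _ = C * (ENNReal.ofReal H * 3 + 1) * ENNReal.ofReal ((σ ^ (-p) * R ^ n) ^ (s * p / n) *
          (2 ^ (s * p) * R ^ (-(s * p)) * σ ^ (-((n : ℝ) + s * p + p)))) *
          scaledEnergy p u x₀ R k κ r₂ ^ (1 + s * p / n) * ENNReal.ofReal (k ^ p * R ^ n) := by
        rw [ENNReal.mul_rpow_of_nonneg _ _ hβ.le, ENNReal.ofReal_rpow_of_pos (by positivity),
          ENNReal.ofReal_mul (by positivity : 0 ≤ (σ ^ (-p) * R ^ n) ^ (s * p / n)),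
          ENNReal.rpow_add_of_nonneg _ _ zero_le_one hβ.le, ENNReal.rpow_one,
          ← ofReal_mul_scaledEnergy hR0 hk0]
        ring
    _ = _ := by
        rw [hscale, ENNReal.ofReal_mul (by positivity)]
        simp only [ENNReal.ofReal]
        push_cast
        ring

lemma ae_le_of_energy_eq_zero (hp : 0 < p) (hu : AEMeasurable u) (h : energy p u k x₀ r = 0) :
    ∀ᵐ x ∂volume.restrict (ball x₀ r), u x ≤ k := by
  have hmeas : AEMeasurable (fun x => ENNReal.ofReal (u x - k) ^ p)
      (volume.restrict (ball x₀ r)) := by have := hu.restrict (s := ball x₀ r); fun_prop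
  filter_upwards [(lintegral_eq_zero_iff' hmeas).1 h] with x hx
  rw [Pi.zero_apply, ENNReal.rpow_eq_zero_iff_of_pos hp, ENNReal.ofReal_eq_zero] at hx
  linarith

/-- The radii `R = r₀ > r₁ > ⋯ → R / 2` of De Giorgi's iteration. -/
noncomputable def iterRadius (R : ℝ) (j : ℕ) : ℝ := R / 2 * (1 + (1 / 2) ^ j)

/-- The levels `0 = k₀ < k₁ < ⋯ → k` of De Giorgi's iteration. -/
noncomputable def iterLevel (k : ℝ) (j : ℕ) : ℝ := k * (1 - (1 / 2) ^ j)

lemma isStep_iter (hR : 0 < R) (hk : 0 ≤ k) (j : ℕ) :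
    IsStep R k ((1 / 2) ^ (j + 2)) (iterRadius R (j + 1)) (iterRadius R j)
      (iterLevel k (j + 1) - iterLevel k j) := by
  have h0 : (0 : ℝ) < (1 / 2) ^ j := by positivity
  have h1 : ((1 : ℝ) / 2) ^ j ≤ 1 := pow_le_one₀ (by norm_num) (by norm_num)
  constructor
  case radius_pos => exact hR
  all_goals simp only [iterRadius, iterLevel, pow_succ]; nlinarith

lemma exists_ae_le_of_scaledEnergy_le (n : ℕ) (hn : 1 ≤ n) (s p H : ℝ) (hs : 0 < s) (hp : 1 < p) :
    ∃ ε : ℝ≥0, 0 < ε ∧ ∀ (Ω : Set (EuclideanSpace ℝ (Fin n))) (d lam : ℝ), 0 ≤ d → 0 ≤ lam →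
      ∀ u, MemWDGPlus s p d H lam Ω u → ∀ x₀ ∈ Ω, ∀ R, 0 < R → R < infDist x₀ (frontier Ω) → ∀ k,
      IsDominatingLevel s p d lam u x₀ R k → scaledEnergy p u x₀ R k 0 R ≤ ε →
      ∀ᵐ x ∂volume.restrict (ball x₀ (R / 2)), u x ≤ k := by
  have hp0 : 0 < p := by linarith
  obtain ⟨γ, hγ⟩ : ∃ γ, γ = (n : ℝ) + s * p + p + p * (s * p / n) := ⟨_, rfl⟩
  obtain ⟨C, hC⟩ := exists_scaledEnergy_add_le n hn s p H hs hp
  obtain ⟨ε, hε, hfast⟩ := exists_forall_tendsto_zero_of_le_mul_pow_mul_rpow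
    (C * 4 ^ γ) (2 ^ γ) (by positivity : 0 < s * p / n)
  refine ⟨ε, hε, fun Ω d lam hd hlam u hu x₀ hx R hR hRΩ k hk hsmall => ?_⟩
  have hk0 := hk.pos
  have hσ : ∀ j : ℕ, ENNReal.ofReal (((1 / 2) ^ (j + 2)) ^ (-γ)) =
      ((4 ^ γ * (2 ^ γ) ^ j : ℝ≥0) : ℝ≥0∞) := fun j => by
    rw [← ENNReal.ofReal_coe_nnreal, one_div, inv_pow, Real.rpow_neg (by positivity),
      Real.inv_rpow (by positivity), inv_inv, pow_add, Real.mul_rpow (by positivity)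
      (by positivity), ← Real.rpow_pow_comm zero_le_two γ j, mul_comm]
    norm_num
  have hlim : Tendsto (fun j => scaledEnergy p u x₀ R k (iterLevel k j) (iterRadius R j)) atTop
      (𝓝 0) := by
    refine hfast _ (by simpa [iterLevel, iterRadius, one_add_one_eq_two] using hsmall) fun j => ?_
    have hstep := hC Ω d lam hd hlam u hu x₀ hx R hRΩ k hk (iterLevel k j) _ _ _ _
      (mul_nonneg hk0.le (sub_nonneg.2 (pow_le_one₀ (by norm_num) (by norm_num))))
      (isStep_iter hR hk0.le j)
    rw [add_sub_cancel, ← hγ, hσ, ENNReal.coe_mul, ← mul_assoc] at hstep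
    exact_mod_cast hstep
  have hzero : scaledEnergy p u x₀ R k k (R / 2) = 0 := by
    refine nonpos_iff_eq_zero.1 (ge_of_tendsto' hlim fun j => ?_)
    refine ENNReal.div_le_div_right (energy_mono hp0.le ?_ ?_) _
    · exact mul_le_of_le_one_right hk0.le (sub_le_self _ (by positivity))
    · exact le_mul_of_one_le_right (by positivity) (le_add_of_nonneg_right (by positivity))
  refine ae_le_of_energy_eq_zero hp0 hu.memTailSpace.1 ?_
  rw [← ofReal_mul_scaledEnergy hR hk0, hzero, mul_zero]

lemma lintegral_ball_rpow_le_of_laverage_rpow_le {q t : ℝ} (hq : 0 < q) (hqp : q ≤ p)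
    (hv : AEMeasurable v) (hr : 0 < r) (ht : 0 ≤ t)
    (h : (⨍⁻ x in ball x₀ r, ‖v x‖ₑ ^ p ∂volume) ^ (1 / p) ≤ ENNReal.ofReal t) :
    ∫⁻ x in ball x₀ r, ‖v x‖ₑ ^ q ≤ ENNReal.ofReal (unitBallVolume n * r ^ n * t ^ q) := by
  have hω := unitBallVolume_pos n
  have : IsFiniteMeasure (volume.restrict (ball x₀ r)) := ⟨by simpa using measure_ball_lt_top⟩
  rw [← measure_mul_setLAverage _ measure_ball_lt_top.ne, volume_ball_eq x₀ hr,
    ENNReal.ofReal_mul (by positivity : 0 ≤ unitBallVolume n * r ^ n)]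
  gcongr
  calc ⨍⁻ x in ball x₀ r, ‖v x‖ₑ ^ q ∂volume
      ≤ (⨍⁻ x in ball x₀ r, ‖v x‖ₑ ^ p ∂volume) ^ (q / p) :=
        laverage_rpow_le_rpow_laverage hq hqp hv.aestronglyMeasurable.restrict
    _ = ((⨍⁻ x in ball x₀ r, ‖v x‖ₑ ^ p ∂volume) ^ (1 / p)) ^ q := by
        rw [← ENNReal.rpow_mul, one_div_mul_eq_div]
    _ ≤ ENNReal.ofReal (t ^ q) := by
        rw [← ENNReal.ofReal_rpow_of_nonneg ht hq.le]
        gcongr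

lemma tailIntegral_half_le_of_mem_ball (hN : 0 ≤ (n : ℝ) + s * p)
    (hR : 0 < R) (hy : y ∈ ball x₀ R) :
    tailIntegral s p v y (R / 2) ≤
      ENNReal.ofReal (3 ^ ((n : ℝ) + s * p)) * tailIntegral s p v x₀ R +
        ENNReal.ofReal ((2 / R) ^ ((n : ℝ) + s * p)) * ∫⁻ x in ball x₀ R, ‖v x‖ₑ ^ (p - 1) := by
  have hfar : ∀ x ∈ (ball y (R / 2))ᶜ, R / 2 ≤ ‖x - y‖ := fun x hx => by
    simpa [dist_eq_norm] using hx
  have hcover : (ball y (R / 2))ᶜ ⊆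
      ((ball x₀ R)ᶜ ∩ (ball y (R / 2))ᶜ) ∪ (ball x₀ R ∩ (ball y (R / 2))ᶜ) := fun x hx => by
    by_cases h : x ∈ ball x₀ R
    · exact Or.inr ⟨h, hx⟩
    · exact Or.inl ⟨h, hx⟩
  refine (lintegral_mono_set hcover).trans ((lintegral_union_le _ _ _).trans (add_le_add ?_ ?_))
  · rw [tailIntegral, ← lintegral_const_mul' _ _ ENNReal.ofReal_ne_top]
    refine le_trans ?_ (lintegral_mono_set (Set.inter_subset_left (t := (ball y (R / 2))ᶜ)))
    refine setLIntegral_mono' (measurableSet_ball.compl.inter measurableSet_ball.compl)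
      fun x hx => div_rpow_le_ofReal_rpow_mul_div_rpow (by norm_num) hN _ ?_
    rw [← ofReal_norm, ← ofReal_norm, ← ENNReal.ofReal_mul (by norm_num)]
    refine ENNReal.ofReal_le_ofReal ?_
    have hxx₀ := norm_sub_le_norm_sub_add_norm_sub x y x₀
    rw [mem_ball, dist_eq_norm] at hy
    linarith [hfar x hx.2]
  · rw [← lintegral_const_mul' _ _ ENNReal.ofReal_ne_top]
    refine le_trans ?_ (lintegral_mono_set (Set.inter_subset_left (t := (ball y (R / 2))ᶜ)))
    refine setLIntegral_mono' (measurableSet_ball.inter measurableSet_ball.compl) fun x hx => ?_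
    have hone : 1 ≤ ENNReal.ofReal (2 / R) * ‖x - y‖ₑ := by
      rw [← ofReal_norm, ← ENNReal.ofReal_mul (by positivity), ENNReal.one_le_ofReal,
        div_mul_eq_mul_div, one_le_div hR]
      linarith [hfar x hx.2]
    simpa using div_rpow_le_ofReal_rpow_mul_div_rpow (by positivity) hN (‖v x‖ₑ ^ (p - 1)) hone

/-- The right-hand side of the local boundedness estimate on `B_R(x₀)`, up to the constant. -/
noncomputable def localBound (s p d lam : ℝ) (v : EuclideanSpace ℝ (Fin n) → ℝ)
    (x₀ : EuclideanSpace ℝ (Fin n)) (R : ℝ) : ℝ≥0∞ :=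
  (⨍⁻ x in ball x₀ (2 * R), ‖v x‖ₑ ^ p ∂volume) ^ (1 / p) + tail s p v x₀ R +
    ENNReal.ofReal (R ^ ((lam + s * p) / p) * d)

lemma tailIntegral_le_of_localBound_le {t : ℝ} (hp : 1 < p) (hR : 0 < R) (ht : 0 ≤ t)
    (h : localBound s p d lam v x₀ R ≤ ENNReal.ofReal t) :
    tailIntegral s p v x₀ R ≤ ENNReal.ofReal (R ^ (-(s * p)) * t ^ (p - 1)) := by
  have hp1 : 0 < p - 1 := by linarith
  have htail : ENNReal.ofReal (R ^ (s * p)) * tailIntegral s p v x₀ R ≤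
      ENNReal.ofReal (t ^ (p - 1)) * 1 := by
    rw [← tail_rpow hp, mul_one, ← ENNReal.ofReal_rpow_of_nonneg ht hp1.le]
    exact ENNReal.rpow_le_rpow ((le_add_self.trans le_self_add).trans h) hp1.le
  simpa [div_eq_inv_mul, Real.rpow_neg hR.le] using le_ofReal_div_mul (by positivity) htail

lemma datum_le_of_localBound_le {t : ℝ} (hp : 0 < p) (hR : 0 < R) (hd : 0 ≤ d) (ht : 0 ≤ t)
    (h : localBound s p d lam v x₀ R ≤ ENNReal.ofReal t) :
    R ^ lam * d ^ p ≤ R ^ (-(s * p)) * t ^ p := by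
  have hdt : R ^ ((lam + s * p) / p) * d ≤ t :=
    (ENNReal.ofReal_le_ofReal_iff ht).1 (le_add_self.trans h)
  calc R ^ lam * d ^ p = R ^ (-(s * p)) * (R ^ ((lam + s * p) / p) * d) ^ p := by
        rw [Real.mul_rpow (by positivity) hd, ← Real.rpow_mul hR.le, div_mul_cancel₀ _ hp.ne',
          ← mul_assoc, ← Real.rpow_add hR]
        ring_nf
    _ ≤ R ^ (-(s * p)) * t ^ p := by gcongr

lemma tailIntegral_half_le_of_localBound_le {t : ℝ} (hp : 1 < p) (hs : 0 ≤ s)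
    (hv : AEMeasurable v) (hR : 0 < R) (ht : 0 ≤ t) (hy : y ∈ ball x₀ R)
    (h : localBound s p d lam v x₀ R ≤ ENNReal.ofReal t) :
    tailIntegral s p v y (R / 2) ≤ ENNReal.ofReal (R ^ (-(s * p)) *
      ((3 ^ ((n : ℝ) + s * p) + 2 ^ ((n : ℝ) + s * p) * (unitBallVolume n * 2 ^ n)) *
        t ^ (p - 1))) := by
  have hω := unitBallVolume_pos n
  have hLp := lintegral_ball_rpow_le_of_laverage_rpow_le (by linarith) (sub_le_self p zero_le_one)
    hv (by positivity : 0 < 2 * R) ht ((le_self_add.trans le_self_add).trans h)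
  calc tailIntegral s p v y (R / 2)
      ≤ ENNReal.ofReal (3 ^ ((n : ℝ) + s * p)) * tailIntegral s p v x₀ R +
        ENNReal.ofReal ((2 / R) ^ ((n : ℝ) + s * p)) *
          ∫⁻ x in ball x₀ R, ‖v x‖ₑ ^ (p - 1) :=
        tailIntegral_half_le_of_mem_ball (by positivity) hR hy
    _ ≤ ENNReal.ofReal (3 ^ ((n : ℝ) + s * p)) *
          ENNReal.ofReal (R ^ (-(s * p)) * t ^ (p - 1)) +
        ENNReal.ofReal ((2 / R) ^ ((n : ℝ) + s * p)) *
          ENNReal.ofReal (unitBallVolume n * (2 * R) ^ n * t ^ (p - 1)) := by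
        gcongr
        · exact tailIntegral_le_of_localBound_le hp hR ht h
        · exact (lintegral_mono_set (ball_subset_ball (by linarith))).trans hLp
    _ = _ := by
        rw [← ENNReal.ofReal_mul (by positivity), ← ENNReal.ofReal_mul (by positivity),
          ← ENNReal.ofReal_add (by positivity) (by positivity),
          Real.div_rpow zero_le_two hR.le, Real.rpow_add hR, Real.rpow_natCast R, mul_pow,
          Real.rpow_neg hR.le]
        congr 1
        field_simp

lemma isDominatingLevel_of_localBound_le {C t : ℝ} (hp : 1 < p) (hs : 0 ≤ s) (hd : 0 ≤ d)
    (hu : AEMeasurable u) (hR : 0 < R) (hC : 1 ≤ C) (ht : 0 < t) (hy : y ∈ ball x₀ R)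
    (hCtail : 3 ^ ((n : ℝ) + s * p) + 2 ^ ((n : ℝ) + s * p) * (unitBallVolume n * 2 ^ n) ≤
      C ^ (p - 1))
    (h : localBound s p d lam (fun x => max (u x) 0) x₀ R ≤ ENNReal.ofReal t) :
    IsDominatingLevel s p d lam u y R (C * t) where
  pos := by positivity
  datum_le := by
    refine (datum_le_of_localBound_le (by linarith) hR hd ht.le h).trans ?_
    gcongr
    exact le_mul_of_one_le_left ht.le hC
  tailIntegral_le := by
    refine (tailIntegral_half_le_of_localBound_le hp hs (hu.max aemeasurable_const)
      hR ht.le hy h).trans (ENNReal.ofReal_le_ofReal ?_)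
    rw [Real.mul_rpow (by positivity) ht.le]
    gcongr

lemma scaledEnergy_le_of_localBound_le {C t : ℝ} {ε : ℝ≥0} (hp : 0 < p) (hu : AEMeasurable u)
    (hR : 0 < R) (hC : 0 < C) (ht : 0 < t) (hy : y ∈ ball x₀ R)
    (hCε : unitBallVolume n * 2 ^ n ≤ C ^ p * ε)
    (h : localBound s p d lam (fun x => max (u x) 0) x₀ R ≤ ENNReal.ofReal t) :
    scaledEnergy p u y R (C * t) 0 R ≤ ε := by
  have hLp := lintegral_ball_rpow_le_of_laverage_rpow_le hp le_rfl (hu.max aemeasurable_const)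
    (by positivity : 0 < 2 * R) ht.le ((le_self_add.trans le_self_add).trans h)
  refine ENNReal.div_le_of_le_mul ?_
  calc energy p u 0 y R ≤ ∫⁻ x in ball x₀ (2 * R), ‖max (u x) 0‖ₑ ^ p := by
        simp only [energy, sub_zero, enorm_max_zero]
        exact lintegral_mono_set (ball_subset_ball' (by linarith [mem_ball.1 hy]))
    _ ≤ ENNReal.ofReal (unitBallVolume n * (2 * R) ^ n * t ^ p) := hLp
    _ = ENNReal.ofReal (unitBallVolume n * 2 ^ n * (t ^ p * R ^ n)) := by ring_nf
    _ ≤ ENNReal.ofReal (C ^ p * ε * (t ^ p * R ^ n)) := by gcongr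
    _ = ε * ENNReal.ofReal ((C * t) ^ p * R ^ n) := by
        rw [← ENNReal.ofReal_coe_nnreal, ← ENNReal.ofReal_mul ε.coe_nonneg,
          Real.mul_rpow hC.le ht.le]
        ring_nf

lemma exists_ae_ofReal_le_mul_localBound (n : ℕ) (hn : 1 ≤ n) (s p H : ℝ) (hs : 0 < s)
    (hp : 1 < p) :
    ∃ C : ℝ≥0, 1 ≤ C ∧ ∀ (Ω : Set (EuclideanSpace ℝ (Fin n))) (d lam : ℝ), 0 ≤ d → 0 ≤ lam →
      ∀ u, MemWDGPlus s p d H lam Ω u → ∀ x₀ ∈ Ω, ∀ R, 0 < R → R < infDist x₀ (frontier Ω) / 2 →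
      ∀ᵐ x ∂volume.restrict (ball x₀ R),
        ENNReal.ofReal (u x) ≤ C * localBound s p d lam (fun x => max (u x) 0) x₀ R := by
  obtain ⟨ε, hε, hmain⟩ := exists_ae_le_of_scaledEnergy_le n hn s p H hs hp
  obtain ⟨C, hC, hCtail, hCε⟩ := exists_one_le_and_le_rpow hp hε
    (3 ^ ((n : ℝ) + s * p) + 2 ^ ((n : ℝ) + s * p) * (unitBallVolume n * 2 ^ n))
    (unitBallVolume n * 2 ^ n)
  refine ⟨C, hC, fun Ω d lam hd hlam u hu x₀ hx₀ R hR hRΩ => ?_⟩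
  have hmeas := hu.memTailSpace.1
  refine ae_ofReal_le_mul_of_forall_ae_le (by positivity) fun t ht hbound => ?_
  refine ae_restrict_of_forall_mem_nhds measurableSet_ball fun y hy =>
    ⟨ball y (R / 2), ball_mem_nhds y (half_pos hR), ?_⟩
  have hyΩ : y ∈ Ω := ball_subset_of_le_infDist_frontier hx₀ (by linarith) hy
  have hRy : R < infDist y (frontier Ω) := by
    linarith [infDist_le_infDist_add_dist (s := frontier Ω) (x := x₀) (y := y), mem_ball'.1 hy]
  exact hmain Ω d lam hd hlam u hu y hyΩ R hR hRy _
    (isDominatingLevel_of_localBound_le hp hs.le hd hmeas hR hC ht hy hCtail hbound)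
    (scaledEnergy_le_of_localBound_le (by linarith) hmeas hR (by positivity) ht hy hCε hbound)

lemma MemWDGMinus.neg (hu : MemWDGMinus s p d H lam Ω u) :
    MemWDGPlus s p d H lam Ω (fun x => -u x) where
  memTailSpace := ⟨hu.memTailSpace.1.neg, by simpa using hu.memTailSpace.2⟩
  memFracSobolev := by
    refine ⟨hu.memFracSobolev.1.neg, ?_⟩
    simpa only [gagliardoSeminorm, neg_sub_neg, enorm_sub_rev] using hu.memFracSobolev.2
  caccioppoli x₀ hx₀ r R hr hrR hR k := by
    have hmax : (fun x => max (-(u x - -k)) 0) = fun x => max (-u x - k) 0 := by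
      funext x
      rw [sub_neg_eq_add, neg_add']
    simpa only [hmax, lt_neg] using hu.caccioppoli x₀ hx₀ r R hr hrR hR (-k)

lemma localBound_mono (hp : 1 < p) (h : ∀ x, ‖v x‖ₑ ≤ ‖w x‖ₑ) :
    localBound s p d lam v x₀ R ≤ localBound s p d lam w x₀ R := by
  have : 0 < p - 1 := by linarith
  unfold localBound tail laverage
  gcongr with x x
  · exact ENNReal.rpow_le_rpow (h x) (by linarith)
  · exact h x

lemma MemTailSpace.tail_lt_top (hs : 0 ≤ s) (hp : 1 < p) (hu : MemTailSpace s p u)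
    (x₀ : EuclideanSpace ℝ (Fin n)) (hR : 0 < R) : tail s p u x₀ R < ∞ := by
  have : 0 < p - 1 := by linarith
  have hN : 0 ≤ (n : ℝ) + s * p := by positivity
  obtain ⟨c, hc⟩ : ∃ c, c = (1 + ‖x₀‖) / R + 1 := ⟨_, rfl⟩
  have hc0 : 0 < c := by rw [hc]; positivity
  have hweight : ∀ x ∈ (ball x₀ R)ᶜ, 1 + ‖x‖ₑ ≤ ENNReal.ofReal c * ‖x - x₀‖ₑ := fun x hx => by
    rw [← ofReal_norm, ← ofReal_norm, ← ENNReal.ofReal_mul hc0.le, ← ENNReal.ofReal_one,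
      ← ENNReal.ofReal_add zero_le_one (norm_nonneg _)]
    refine ENNReal.ofReal_le_ofReal ?_
    have hfar : R ≤ ‖x - x₀‖ := by simpa [dist_eq_norm] using hx
    have hscale : 1 + ‖x₀‖ ≤ (1 + ‖x₀‖) / R * ‖x - x₀‖ := by
      rw [div_mul_eq_mul_div, le_div_iff₀ hR]
      gcongr
    rw [hc]
    linarith [norm_le_norm_sub_add x x₀]
  refine ENNReal.rpow_lt_top_of_nonneg (by positivity)
    (ENNReal.mul_lt_top ENNReal.ofReal_lt_top ?_).ne
  calc ∫⁻ x in (ball x₀ R)ᶜ, ‖u x‖ₑ ^ (p - 1) / ‖x - x₀‖ₑ ^ ((n : ℝ) + s * p)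
      ≤ ∫⁻ x in (ball x₀ R)ᶜ, ENNReal.ofReal (c ^ ((n : ℝ) + s * p)) *
          (‖u x‖ₑ ^ (p - 1) / (1 + ‖x‖ₑ) ^ ((n : ℝ) + s * p)) :=
        setLIntegral_mono' measurableSet_ball.compl fun x hx =>
          div_rpow_le_ofReal_rpow_mul_div_rpow hc0 hN _ (hweight x hx)
    _ ≤ ENNReal.ofReal (c ^ ((n : ℝ) + s * p)) *
          ∫⁻ x, ‖u x‖ₑ ^ (p - 1) / (1 + ‖x‖ₑ) ^ ((n : ℝ) + s * p) := by
        rw [← lintegral_const_mul' _ _ ENNReal.ofReal_ne_top]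
        exact setLIntegral_le_lintegral _ _
    _ < ∞ := ENNReal.mul_lt_top ENNReal.ofReal_lt_top hu.2

lemma MemFracSobolev.laverage_lt_top (hp : 0 < p) (hu : MemFracSobolev s p u Ω) (hr : 0 < r)
    (hball : ball x₀ r ⊆ Ω) : ⨍⁻ x in ball x₀ r, ‖u x‖ₑ ^ p ∂volume < ∞ := by
  rw [setLAverage_eq]
  refine ENNReal.div_lt_top ((lintegral_mono_set hball).trans_lt ?_).ne
    (measure_ball_pos _ _ hr).ne'
  rw [← eLpNorm_ofReal_rpow hp]
  exact ENNReal.rpow_lt_top_of_nonneg hp.le hu.1.2.ne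

lemma MemWDGPlus.localBound_lt_top (hs : 0 ≤ s) (hp : 1 < p) (hu : MemWDGPlus s p d H lam Ω u)
    (hx₀ : x₀ ∈ Ω) (hR : 0 < R) (hRΩ : R < infDist x₀ (frontier Ω) / 2) :
    localBound s p d lam u x₀ R < ∞ := by
  have hp0 : 0 < p := by linarith
  have hball : ball x₀ (2 * R) ⊆ Ω := ball_subset_of_le_infDist_frontier hx₀ (by linarith)
  have hmean := hu.memFracSobolev.laverage_lt_top hp0 (by positivity) hball
  exact ENNReal.add_lt_top.2 ⟨ENNReal.add_lt_top.2
    ⟨ENNReal.rpow_lt_top_of_nonneg (by positivity) hmean.ne,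
      hu.memTailSpace.tail_lt_top hs hp x₀ hR⟩, ENNReal.ofReal_lt_top⟩

lemma memLinftyLoc_of_forall_eLpNorm_lt_top (hu : AEMeasurable u)
    (h : ∀ x ∈ Ω, ∃ V ∈ 𝓝 x, eLpNorm u ∞ (volume.restrict V) < ∞) : MemLinftyLoc Ω u := by
  intro K hKΩ hK
  choose! V hV hVu using h
  obtain ⟨F, hFK, hcover⟩ := hK.elim_nhds_subcover V fun x hx => hV x (hKΩ hx)
  have hbound : ∀ᵐ x ∂volume.restrict (⋃ y ∈ F, V y),
      ‖u x‖ₑ ≤ F.sup fun y => eLpNorm u ∞ (volume.restrict (V y)) := by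
    refine (ae_restrict_biUnion_finset_iff _ _ _).2 fun y hy => ?_
    filter_upwards [ae_le_eLpNormEssSup (f := u) (μ := volume.restrict (V y))] with x hx
    rw [← eLpNorm_exponent_top] at hx
    exact hx.trans (Finset.le_sup (f := fun y => eLpNorm u ∞ (volume.restrict (V y))) hy)
  refine ⟨hu.aestronglyMeasurable.restrict, ?_⟩
  calc eLpNorm u ∞ (volume.restrict K)
      ≤ F.sup fun y => eLpNorm u ∞ (volume.restrict (V y)) := by
        rw [eLpNorm_exponent_top]
        exact eLpNormEssSup_le_of_ae_enorm_bound
          (ae_restrict_of_ae_restrict_of_subset hcover hbound)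
    _ < ∞ := (Finset.sup_lt_iff ENNReal.zero_lt_top).2 fun y hy => hVu y (hKΩ (hFK y hy))

lemma eLpNorm_top_le_mul_localBound {C : ℝ≥0} (hp : 1 < p)
    (hpos : ∀ᵐ x ∂volume.restrict (ball x₀ R),
      ENNReal.ofReal (u x) ≤ C * localBound s p d lam (fun x => max (u x) 0) x₀ R)
    (hneg : ∀ᵐ x ∂volume.restrict (ball x₀ R),
      ENNReal.ofReal (-u x) ≤ C * localBound s p d lam (fun x => max (-u x) 0) x₀ R) :
    eLpNorm u ∞ (volume.restrict (ball x₀ R)) ≤ C * localBound s p d lam u x₀ R := by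
  rw [eLpNorm_exponent_top]
  refine eLpNormEssSup_le_of_ae_enorm_bound ?_
  filter_upwards [hpos, hneg] with x hxpos hxneg
  refine enorm_le_of_ofReal_le (hxpos.trans ?_) (hxneg.trans ?_)
  · gcongr
    exact localBound_mono hp fun x => (enorm_max_zero _).trans_le (Real.ofReal_le_enorm _)
  · gcongr
    refine localBound_mono hp fun x => (enorm_max_zero _).trans_le ?_
    exact (Real.ofReal_le_enorm _).trans_eq (enorm_neg _)

end FracDeGiorgi

open FracDeGiorgi Metric in
theorem theorem2p2_general (n : ℕ) (hn : 1 ≤ n) (s p H : ℝ) (hs : 0 < s) (hp : 1 < p) :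
    ∃ C : ℝ≥0, 1 ≤ C ∧ ∀ Ω : Set (EuclideanSpace ℝ (Fin n)), IsOpen Ω → Ω ≠ Set.univ →
      ∀ d lam : ℝ, 0 ≤ d → 0 ≤ lam → ∀ u : EuclideanSpace ℝ (Fin n) → ℝ,
      (MemWDG s p d H lam Ω u → MemLinftyLoc Ω u ∧
        ∀ x₀ ∈ Ω, ∀ R, 0 < R → R < infDist x₀ (frontier Ω) / 2 →
          eLpNorm u ∞ (volume.restrict (ball x₀ R)) ≤ C * localBound s p d lam u x₀ R) ∧
      (MemWDGPlus s p d H lam Ω u →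
        ∀ x₀ ∈ Ω, ∀ R, 0 < R → R < infDist x₀ (frontier Ω) / 2 →
          essSup (fun x => (u x : EReal)) (volume.restrict (ball x₀ R)) ≤
            ((C * localBound s p d lam (fun x => max (u x) 0) x₀ R : ℝ≥0∞) : EReal)) := by
  obtain ⟨C, hC1, hC⟩ := exists_ae_ofReal_le_mul_localBound n hn s p H hs hp
  refine ⟨C, hC1, fun Ω hΩ hne d lam hd hlam u => ⟨fun hu => ?_, fun hu x₀ hx₀ R hR hRΩ =>
    essSup_coe_le_of_ae_ofReal_le (hC Ω d lam hd hlam u hu x₀ hx₀ R hR hRΩ)⟩⟩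
  have hest : ∀ x₀ ∈ Ω, ∀ R, 0 < R → R < infDist x₀ (frontier Ω) / 2 →
      eLpNorm u ∞ (volume.restrict (ball x₀ R)) ≤ C * localBound s p d lam u x₀ R :=
    fun x₀ hx₀ R hR hRΩ => eLpNorm_top_le_mul_localBound hp
      (hC Ω d lam hd hlam u hu.1 x₀ hx₀ R hR hRΩ) (hC Ω d lam hd hlam _ hu.2.neg x₀ hx₀ R hR hRΩ)
  refine ⟨memLinftyLoc_of_forall_eLpNorm_lt_top hu.1.memTailSpace.1 fun x hx => ?_, hest⟩
  obtain ⟨R, hR, hRΩ⟩ := exists_between (half_pos (infDist_frontier_pos hΩ hne hx))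
  exact ⟨ball x R, ball_mem_nhds x hR, (hest x hx R hR hRΩ).trans_lt
    (ENNReal.mul_lt_top ENNReal.coe_lt_top (hu.1.localBound_lt_top hs.le hp hx hR hRΩ))⟩

theorem theorem2p2 (n : ℕ) (hn : 1 ≤ n) (s p H : ℝ) (hs0 : 0 < s) (hs1 : s < 1) (hp : 1 < p)
    (hsp : s * p < (n : ℝ)) (hH : 1 ≤ H) :
    -- local boundedness of functions in `wDG`, with the two-sided estimate
    (∃ C : ℝ≥0, 1 ≤ C ∧
      ∀ Ω : Set (EuclideanSpace ℝ (Fin n)), IsOpen Ω → Bornology.IsBounded Ω →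
      ∀ d lam : ℝ, 0 ≤ d → 0 ≤ lam →
      ∀ u : EuclideanSpace ℝ (Fin n) → ℝ, FracDeGiorgi.MemWDG s p d H lam Ω u →
        FracDeGiorgi.MemLinftyLoc Ω u ∧
        ∀ x₀ ∈ Ω, ∀ R : ℝ, 0 < R → R < Metric.infDist x₀ (frontier Ω) / 2 →
          eLpNorm u ∞ (volume.restrict (Metric.ball x₀ R)) ≤
            (C : ℝ≥0∞) * ((⨍⁻ x in Metric.ball x₀ (2 * R), ‖u x‖ₑ ^ p ∂volume) ^ (1 / p)
              + FracDeGiorgi.tail s p u x₀ R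
              + ENNReal.ofReal (R ^ ((lam + s * p) / p) * d))) ∧
    -- the one-sided estimate for functions in `wDG⁺`
    (∃ C : ℝ≥0, 1 ≤ C ∧
      ∀ Ω : Set (EuclideanSpace ℝ (Fin n)), IsOpen Ω → Bornology.IsBounded Ω →
      ∀ d lam : ℝ, 0 ≤ d → 0 ≤ lam →
      ∀ u : EuclideanSpace ℝ (Fin n) → ℝ, FracDeGiorgi.MemWDGPlus s p d H lam Ω u →
        ∀ x₀ ∈ Ω, ∀ R : ℝ, 0 < R → R < Metric.infDist x₀ (frontier Ω) / 2 →
          essSup (fun x => (u x : EReal)) (volume.restrict (Metric.ball x₀ R)) ≤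
            (((C : ℝ≥0∞) * ((⨍⁻ x in Metric.ball x₀ (2 * R), ENNReal.ofReal (u x) ^ p ∂volume) ^ (1 / p)
              + FracDeGiorgi.tail s p (fun x => max (u x) 0) x₀ R
              + ENNReal.ofReal (R ^ ((lam + s * p) / p) * d)) : ℝ≥0∞) : EReal)) := by
  have : NeZero n := ⟨by omega⟩
  have hne (Ω : Set (EuclideanSpace ℝ (Fin n))) (hb : Bornology.IsBounded Ω) : Ω ≠ Set.univ :=
    fun h => NormedSpace.unbounded_univ ℝ (EuclideanSpace ℝ (Fin n)) (h ▸ hb)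
  obtain ⟨C, hC1, hC⟩ := theorem2p2_general n hn s p H hs0 hp
  simp only [FracDeGiorgi.localBound, FracDeGiorgi.enorm_max_zero] at hC
  exact ⟨⟨C, hC1, fun Ω hΩ hb d lam hd hlam u => (hC Ω hΩ (hne Ω hb) d lam hd hlam u).1⟩,
    C, hC1, fun Ω hΩ hb d lam hd hlam u => (hC Ω hΩ (hne Ω hb) d lam hd hlam u).2⟩
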